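/- Let $n_0,n_1\ge 0$ and $n_2\ge 1$ be integers and let $K\subset\mathbb R^{n_0}$ be compact and connected with non-empty interior. Let $\mathcal H=\mathcal H^{\mathrm{full}}_K(n_0,n_1,n_2)$ be the set of restrictions to $K$ of the shallow ReLU networks $f_2\circ\mathrm{ReLU}\circ f_1$, where $f_1:\mathbb R^{n_0}\to\mathbb R^{n_1}$ and $f_2:\mathbb R^{n_1}\to\mathbb R^{n_2}$ are affine and $\mathrm{ReLU}(x)=(\max\{0,x_1\},\dots,\max\{0,x_{n_1}\})$. A connected region is a non-empty connected open set together with none, some or all of its boundary points. A linear region of $f:K\to\mathbb R^{n_2}$ is a connected region $D\subset K$ such that $f|_D$ is the restriction of an affine map and $D$ is maximal under inclusion with this property. Let $c^{\#}(f)$ be the number of linear regions of $f$. Two linear regions $D,D'$ of $f$ are equivalent if there is a Euclidean transformation $\phi(x)=Ax+b$ of $\mathbb R^{n_0}$ ($A$ orthogonal) with $\phi(D)=D'$ and $f|_D=f|_{D'}\circ\phi|_D$; let $c^{\sim}(f)$ be the number of equivalence classes. Put $c^{\#}(\mathcal H)=\sup_{f\in\mathcal H}c^{\#}(f)$ and $c^{\sim}(\mathcal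 H)=\sup_{f\in\mathcal H}c^{\sim}(f)$, in $\mathbb N\cup\{\infty\}$. 1. If $K$ is convex, then $$c^{\sim}(\mathcal H)=c^{\#}(\mathcal H)=\sum_{i=0}^{n_0}\binom{n_1}{i},$$ and the suprema are attained: some $F\in\mathcal H$ has $c^{\sim}(F)=\sum_{i=0}^{n_0}\binom{n_1}{i}$. 2. For every $K$ as above, $\displaystyle\sum_{i=0}^{n_0}\binom{n_1}{i}\le c^{\sim}(\mathcal H)\le c^{\#}(\mathcal H)$. 3. For every $K$ as above, if $0<n_0<n_1$, then $$c^{\sim}(\mathcal H)\ \ge\ \frac{2^{\,n_1H(n_0/n_1)}}{\sqrt{8n_0(1-n_0/n_1)}},\qquad H(p)=-p\log_2 p-(1-p)\log_2(1-p).$$ -/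

import Mathlib

open scoped ENNReal

namespace ReluRegions

/-- `ℝⁿ` with its Euclidean norm. -/
abbrev E (n : ℕ) : Type := EuclideanSpace ℝ (Fin n)

/-- The rectifier, applied coordinatewise. -/
noncomputable def relu {n : ℕ} (x : E n) : E n := WithLp.toLp 2 fun i => max 0 (x i)

/-- The restrictions to `K` of the shallow fully connected ReLU networks `f₂ ∘ ReLU ∘ f₁`,
with `f₁ : ℝ^{n₀} → ℝ^{n₁}` and `f₂ : ℝ^{n₁} → ℝ^{n₂}` affine. -/
def fullNetworks (n₀ n₁ n₂ : ℕ) (K : Set (E n₀)) : Set (K → E n₂) :=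
  {F | ∃ (f₁ : E n₀ →ᵃ[ℝ] E n₁) (f₂ : E n₁ →ᵃ[ℝ] E n₂), ∀ x : K, F x = f₂ (relu (f₁ x))}

section

variable {n m : ℕ} {K : Set (E n)}

/-- A connected region of `ℝⁿ`: a nonempty connected open set together with
none, some or all of its boundary points. -/
def IsRegion (D : Set (E n)) : Prop :=
  IsConnected (interior D) ∧ D ⊆ closure (interior D)

/-- `f` is linear (that is, affine) on `D`: it is there the restriction of an affine map. -/
def IsLinearOn (f : K → E m) (D : Set (E n)) : Prop :=
  ∃ A : E n →ᵃ[ℝ] E m, ∀ x : K, (x : E n) ∈ D → f x = A x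

/-- A linear region of `f`: a connected region contained in `K` on which `f` is linear, and which
is maximal (with respect to inclusion) among all such regions. -/
def IsLinearRegion (f : K → E m) (D : Set (E n)) : Prop :=
  Maximal (fun D' : Set (E n) => D' ⊆ K ∧ IsRegion D' ∧ IsLinearOn f D') D

/-- The index set of the set of linear functions `(f|_D, D)` of `f`; the linear function `f|_D` is
determined by the linear region `D`. -/
abbrev LinearRegion (f : K → E m) : Type := {D : Set (E n) // IsLinearRegion f D}

/-- `(f|_D, D) ∼ (f|_D', D')`: there is a Euclidean transformation `φ` of `ℝⁿ` with `φ(D) = D'`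
and `f|_D = f|_D' ∘ φ|_D`. -/
def EuclideanEquiv (f : K → E m) (D D' : Set (E n)) : Prop :=
  ∃ φ : E n ≃ᵃⁱ[ℝ] E n, φ '' D = D' ∧
    ∀ x y : K, (x : E n) ∈ D → (y : E n) = φ x → f x = f y

theorem EuclideanEquiv.refl (f : K → E m) (D : Set (E n)) : EuclideanEquiv f D D := by
  refine ⟨AffineIsometryEquiv.refl ℝ (E n), by simp, ?_⟩
  intro x y _ h
  have : y = x := Subtype.ext (by simpa using h)
  rw [this]

theorem EuclideanEquiv.symm {f : K → E m} {D D' : Set (E n)}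
    (h : EuclideanEquiv f D D') : EuclideanEquiv f D' D := by
  obtain ⟨φ, hφ, hf⟩ := h
  have hD : φ.symm '' D' = D := by
    rw [← hφ, Set.image_image]
    simp
  refine ⟨φ.symm, hD, ?_⟩
  intro x y hx hy
  refine (hf y x ?_ ?_).symm
  · rw [hy, ← hD]
    exact Set.mem_image_of_mem _ hx
  · rw [hy]
    simp

theorem EuclideanEquiv.trans {f : K → E m} {D D' D'' : Set (E n)} (hD' : D' ⊆ K)
    (h : EuclideanEquiv f D D') (h' : EuclideanEquiv f D' D'') : EuclideanEquiv f D D'' := by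
  obtain ⟨φ, hφ, hf⟩ := h
  obtain ⟨ψ, hψ, hg⟩ := h'
  refine ⟨φ.trans ψ, ?_, ?_⟩
  · rw [← hψ, ← hφ, Set.image_image]
    rfl
  · intro x y hx hy
    have hm : φ x ∈ D' := by
      rw [← hφ]
      exact Set.mem_image_of_mem _ hx
    exact (hf x ⟨φ x, hD' hm⟩ hx rfl).trans (hg ⟨φ x, hD' hm⟩ y hm hy)

/-- The equivalence relation `∼` on the set of linear functions of `f`. -/
def linearRegionSetoid (f : K → E m) : Setoid (LinearRegion f) where
  r D D' := EuclideanEquiv f D.1 D'.1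
  iseqv :=
    { refl := fun D => EuclideanEquiv.refl f D.1
      symm := fun h => h.symm
      trans := fun {_ D' _} h h' => EuclideanEquiv.trans D'.2.1.1 h h' }

/-- The number `c^#(f)` of linear regions of `f`. -/
noncomputable def numLinearRegions (f : K → E m) : ℕ∞ := ENat.card (LinearRegion f)

/-- The measure of complexity `c^∼(f)`: the number of `∼`-classes of linear functions of `f`. -/
noncomputable def complexity (f : K → E m) : ℕ∞ := ENat.card (Quotient (linearRegionSetoid f))

/-- `c^#` of a set of functions: the largest number of linear regions of its members (as a
supremum in `ℕ ∪ {∞}`; when it is finite and the set is nonempty, it is attained). -/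
noncomputable def maxLinearRegions (𝓗 : Set (K → E m)) : ℕ∞ := ⨆ f ∈ 𝓗, numLinearRegions f

/-- `c^∼` of a set of functions: the largest complexity of its members (as a
supremum in `ℕ ∪ {∞}`; when it is finite and the set is nonempty, it is attained). -/
noncomputable def maxComplexity (𝓗 : Set (K → E m)) : ℕ∞ := ⨆ f ∈ 𝓗, complexity f

end

/-- The binary entropy function in base `2` (`Real.logb 2 0 = 0`, so it vanishes at `0` and `1`). -/
noncomputable def binaryEntropy (p : ℝ) : ℝ :=
  -p * Real.logb 2 p - (1 - p) * Real.logb 2 (1 - p)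

end ReluRegions

/-! Upper bound: every linear region contains a generic point, at which no unit vanishes unless it
vanishes identically. For convex `K`, two such points with the same active units lie in one convex
cell where the network is affine, hence in a single linear region (`numLinearRegions_le`). So
regions inject into the activation patterns, and these form a set family of VC dimension at most
`n`: more than `n` affine functionals on `ℝⁿ` satisfy an affine relation, which excludes some sign
patterns. Sauer–Shelah gives the binomial sum.

Lower bound: let unit `i` evaluate at `i` the monic polynomial of degree `n` whose lower
coefficients are the input. Prescribing sign changes at at most `n` half-integers realises enough
patterns, and scaling moves them into `K`. A Euclidean equivalence preserves the norm of the
gradient, and suitable output weights make the gradients of all patterns differ in norm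
(`exists_weights_norm_injective`), so these regions are pairwise inequivalent.

The entropy bound keeps only the last binomial coefficient and rests on `stirlingSeq_mul_le`. -/

namespace ReluRegions

/-! ### Existence and disjointness of linear regions -/

section Regions

variable {n m : ℕ} {K : Set (E n)} {f : K → E m}

/-- A set with non-empty interior affinely spans the space. This makes the affine map of a region
unique, so overlapping regions can be merged. -/
theorem affineMap_eq_of_agree {A A' : E n →ᵃ[ℝ] E m} {U : Set (E n)}
    (hU : (interior U).Nonempty) (hUK : U ⊆ K)
    (hA : ∀ x : K, (x : E n) ∈ U → f x = A x) (hA' : ∀ x : K, (x : E n) ∈ U → f x = A' x) :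
    A = A' := by
  refine AffineMap.ext_on (isOpen_interior.affineSpan_eq_top hU) fun x hx => ?_
  have hxU := interior_subset hx
  exact (hA ⟨x, hUK hxU⟩ hxU).symm.trans (hA' ⟨x, hUK hxU⟩ hxU)

theorem isRegion_of_isOpen {U D : Set (E n)} (hU : IsOpen U) (hc : IsConnected U)
    (hUD : U ⊆ D) (hD : D ⊆ closure U) : IsRegion D :=
  have hi : U ⊆ interior D := interior_maximal hUD hU
  ⟨hc.subset_closure hi (interior_subset.trans hD), hD.trans (closure_mono hi)⟩

theorem isRegion_of_convex {U : Set (E n)} (hU : IsOpen U) (hc : Convex ℝ U)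
    (hne : U.Nonempty) : IsRegion U :=
  isRegion_of_isOpen hU (hc.isConnected hne) subset_rfl subset_closure

theorem IsLinearRegion.subset {D : Set (E n)} (h : IsLinearRegion f D) : D ⊆ K := h.1.1

theorem IsLinearRegion.interior_nonempty {D : Set (E n)} (h : IsLinearRegion f D) :
    (interior D).Nonempty := h.1.2.1.1.nonempty

/-- Every region on which `f` is linear lies in a linear region. -/
theorem exists_isLinearRegion_superset {D : Set (E n)} (hDK : D ⊆ K) (hD : IsRegion D)
    (hf : IsLinearOn f D) : ∃ D', IsLinearRegion f D' ∧ D ⊆ D' := by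
  -- No Zorn argument is needed: all candidates containing `D` share its interior and hence its
  -- affine map, so their union is again a candidate.
  let S : Set (Set (E n)) := {D' | (D' ⊆ K ∧ IsRegion D' ∧ IsLinearOn f D') ∧ D ⊆ D'}
  have hDS : D ∈ S := ⟨⟨hDK, hD, hf⟩, subset_rfl⟩
  have hDM : D ⊆ ⋃₀ S := Set.subset_sUnion_of_mem hDS
  obtain ⟨x, hx⟩ := hD.1.nonempty
  obtain ⟨A, hA⟩ := hf
  refine ⟨⋃₀ S, ⟨⟨Set.sUnion_subset fun D' h => h.1.1, ?_, A, ?_⟩, ?_⟩, hDM⟩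
  · refine isRegion_of_isOpen (U := ⋃₀ (interior '' S)) ?_ ⟨?_, ?_⟩ ?_ ?_
    · exact isOpen_sUnion (by rintro _ ⟨D', _, rfl⟩; exact isOpen_interior)
    · exact ⟨x, interior D, ⟨D, hDS, rfl⟩, hx⟩
    · refine isPreconnected_sUnion x _ ?_ ?_
      · rintro _ ⟨D', h, rfl⟩; exact interior_mono h.2 hx
      · rintro _ ⟨D', h, rfl⟩; exact h.1.2.1.1.isPreconnected
    · rintro y ⟨_, ⟨D', h, rfl⟩, hy⟩
      exact ⟨D', h, interior_subset hy⟩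
    · rintro y ⟨D', h, hy⟩
      exact closure_mono (Set.subset_sUnion_of_mem (Set.mem_image_of_mem _ h)) (h.1.2.1.2 hy)
  · rintro y ⟨D', h, hy⟩
    obtain ⟨A', hA'⟩ := h.1.2.2
    rw [hA' y hy, affineMap_eq_of_agree ⟨x, hx⟩ hDK hA fun z hz => hA' z (h.2 hz)]
  · exact fun D' h hle => Set.subset_sUnion_of_mem ⟨h, hDM.trans hle⟩

/-- Linear regions whose interiors meet are equal. -/
theorem IsLinearRegion.eq_of_interior_inter {D D' : Set (E n)} (h : IsLinearRegion f D)
    (h' : IsLinearRegion f D') (hne : (interior D ∩ interior D').Nonempty) : D = D' := by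
  obtain ⟨hK, hR, A, hA⟩ := h.1
  obtain ⟨hK', hR', A', hA'⟩ := h'.1
  have hAA : A = A' := affineMap_eq_of_agree (U := D ∩ D') (by rwa [interior_inter])
    (Set.inter_subset_left.trans hK) (fun x hx => hA x hx.1) fun x hx => hA' x hx.2
  have hU : D ∪ D' ⊆ K ∧ IsRegion (D ∪ D') ∧ IsLinearOn f (D ∪ D') := by
    refine ⟨Set.union_subset hK hK', isRegion_of_isOpen (isOpen_interior.union isOpen_interior)
      (hR.1.union hne hR'.1) (Set.union_subset_union interior_subset interior_subset) ?_, A, ?_⟩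
    · rw [closure_union]
      exact Set.union_subset_union hR.2 hR'.2
    · rintro x (hx | hx)
      · exact hA x hx
      · rw [hA' x hx, hAA]
  exact (h.eq_of_ge hU Set.subset_union_left).symm.trans (h'.eq_of_ge hU Set.subset_union_right)

theorem complexity_le_numLinearRegions (f : K → E m) : complexity f ≤ numLinearRegions f :=
  ENat.card_le_card_of_injective Quotient.out_injective

theorem maxComplexity_le_maxLinearRegions (𝓗 : Set (K → E m)) :
    maxComplexity 𝓗 ≤ maxLinearRegions 𝓗 :=
  iSup₂_mono fun f _ => complexity_le_numLinearRegions f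

end Regions

/-! ### Activation patterns and open cells -/

section Activation

variable {n k m : ℕ}

/-- The projection that keeps the coordinates in `S` and annihilates the others. -/
noncomputable def mask (S : Finset (Fin n)) : E n →ₗ[ℝ] E n where
  toFun x := WithLp.toLp 2 fun i => if i ∈ S then x i else 0
  map_add' x y := by ext i; by_cases h : i ∈ S <;> simp [h]
  map_smul' c x := by ext i; by_cases h : i ∈ S <;> simp [h]

@[simp]
theorem mask_apply (S : Finset (Fin n)) (x : E n) (i : Fin n) :
    mask S x i = if i ∈ S then x i else 0 := rfl

open Classical in
/-- The units that are active at `x`. -/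
noncomputable def activeSet (f₁ : E n →ᵃ[ℝ] E k) (x : E n) : Finset (Fin k) :=
  {i | 0 < f₁ x i}

@[simp]
theorem mem_activeSet {f₁ : E n →ᵃ[ℝ] E k} {x : E n} {i : Fin k} :
    i ∈ activeSet f₁ x ↔ 0 < f₁ x i := by simp [activeSet]

/-- The affine map with which the network `f₂ ∘ relu ∘ f₁` agrees where the units in `S` are
active and the others are not. -/
noncomputable def maskedMap (f₁ : E n →ᵃ[ℝ] E k) (f₂ : E k →ᵃ[ℝ] E m) (S : Finset (Fin k)) :
    E n →ᵃ[ℝ] E m :=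
  f₂.comp ((mask S).toAffineMap.comp f₁)

/-- The `i`-th coordinate of an affine map. -/
noncomputable def coordMap (f₁ : E n →ᵃ[ℝ] E k) (i : Fin k) : E n →ᵃ[ℝ] ℝ :=
  (EuclideanSpace.proj i : E k →L[ℝ] ℝ).toLinearMap.toAffineMap.comp f₁

@[simp]
theorem coordMap_apply (f₁ : E n →ᵃ[ℝ] E k) (i : Fin k) (x : E n) :
    coordMap f₁ i x = f₁ x i := rfl

theorem continuous_coordMap (f₁ : E n →ᵃ[ℝ] E k) (i : Fin k) : Continuous (coordMap f₁ i) :=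
  (coordMap f₁ i).continuous_of_finiteDimensional

/-- The points at which no unit vanishes that does not vanish identically. -/
def IsGeneric (f₁ : E n →ᵃ[ℝ] E k) (x : E n) : Prop :=
  ∀ i, coordMap f₁ i ≠ 0 → f₁ x i ≠ 0

/-- A non-zero affine function vanishes on no non-empty open set, so the conditions define finitely
many dense open sets. -/
theorem exists_isGeneric (f₁ : E n →ᵃ[ℝ] E k) {U : Set (E n)} (hU : IsOpen U)
    (hne : U.Nonempty) : ∃ x ∈ U, IsGeneric f₁ x := by
  have hd : Dense (⋂ i : Fin k, {x | coordMap f₁ i ≠ 0 → f₁ x i ≠ 0}) := by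
    refine dense_iInter_of_isOpen (fun i => ?_) fun i => ?_ <;>
      by_cases h : coordMap f₁ i = 0
    · simp [h]
    · simpa [h] using isOpen_ne_fun (continuous_coordMap f₁ i) continuous_const
    · simp [h]
    · refine dense_iff_inter_open.2 fun V hV hVne => ?_
      by_contra hcon
      refine h (AffineMap.ext_on (hV.affineSpan_eq_top hVne) fun x hx => ?_)
      by_contra hx0
      exact hcon ⟨x, hx, fun _ => hx0⟩
  obtain ⟨x, hxU, hx⟩ := hd.inter_open_nonempty U hU hne
  exact ⟨x, hxU, Set.mem_iInter.1 hx⟩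

/-- The part in `U` of the open cell with active units `S`. -/
def cell (f₁ : E n →ᵃ[ℝ] E k) (U : Set (E n)) (S : Finset (Fin k)) : Set (E n) :=
  U ∩ ⋂ i : Fin k, {x | coordMap f₁ i ≠ 0 → if i ∈ S then 0 < f₁ x i else f₁ x i < 0}

theorem cell_subset (f₁ : E n →ᵃ[ℝ] E k) (U : Set (E n)) (S : Finset (Fin k)) :
    cell f₁ U S ⊆ U := Set.inter_subset_left

theorem mem_cell_of_isGeneric {f₁ : E n →ᵃ[ℝ] E k} {U : Set (E n)} {x : E n} (hx : x ∈ U)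
    (hg : IsGeneric f₁ x) : x ∈ cell f₁ U (activeSet f₁ x) := by
  refine ⟨hx, Set.mem_iInter.2 fun i hi => ?_⟩
  split_ifs with h
  · exact mem_activeSet.1 h
  · exact lt_of_le_of_ne (not_lt.1 fun h' => h (mem_activeSet.2 h')) (hg i hi)

theorem isOpen_cell (f₁ : E n →ᵃ[ℝ] E k) {U : Set (E n)} (hU : IsOpen U) (S : Finset (Fin k)) :
    IsOpen (cell f₁ U S) := by
  refine hU.inter (isOpen_iInter_of_finite fun i => ?_)
  by_cases h : coordMap f₁ i = 0
  · simp [h]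
  by_cases hi : i ∈ S
  · simpa [h, hi] using isOpen_lt continuous_const (continuous_coordMap f₁ i)
  · simpa [h, hi] using isOpen_lt (continuous_coordMap f₁ i) continuous_const

theorem convex_cell (f₁ : E n →ᵃ[ℝ] E k) {U : Set (E n)} (hU : Convex ℝ U) (S : Finset (Fin k)) :
    Convex ℝ (cell f₁ U S) := by
  refine hU.inter (convex_iInter fun i => ?_)
  by_cases h : coordMap f₁ i = 0
  · simp [h, convex_univ]
  by_cases hi : i ∈ S
  · simpa [h, hi, Set.preimage] using (convex_Ioi (0 : ℝ)).affine_preimage (coordMap f₁ i)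
  · simpa [h, hi, Set.preimage] using (convex_Iio (0 : ℝ)).affine_preimage (coordMap f₁ i)

/-- Units that vanish identically are unconstrained in the cell; they contribute zero whether or not
they are masked. -/
theorem cell_eq_maskedMap {f₁ : E n →ᵃ[ℝ] E k} (f₂ : E k →ᵃ[ℝ] E m) {U : Set (E n)}
    {S : Finset (Fin k)} {x : E n} (hx : x ∈ cell f₁ U S) :
    f₂ (relu (f₁ x)) = maskedMap f₁ f₂ S x := by
  suffices h : relu (f₁ x) = mask S (f₁ x) by rw [h]; rfl
  ext i
  have hi := Set.mem_iInter.1 hx.2 i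
  by_cases h : coordMap f₁ i = 0
  · have h0 : f₁ x i = 0 := by rw [← coordMap_apply, h]; rfl
    simp [relu, h0]
  · have := hi h
    split_ifs at this with hS
    · simp [relu, hS, this.le]
    · simp [relu, hS, this.le]

end Activation

/-! ### Upper bound by VC dimension -/

section UpperBound

variable {n k m : ℕ}

open Classical in
/-- The family of the sets of units that are active at a common point. -/
noncomputable def activeFamily (f₁ : E n →ᵃ[ℝ] E k) : Finset (Finset (Fin k)) :=
  {S | ∃ x, activeSet f₁ x = S}

/-- The dual of `ℝⁿ` has dimension `n`, so the linear parts are dependent; the same combination of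
the affine maps is constant. -/
theorem exists_affine_relation (f₁ : E n →ᵃ[ℝ] E k) {T : Finset (Fin k)} (hT : n < T.card) :
    ∃ c : Fin k → ℝ, (∃ i ∈ T, c i ≠ 0) ∧ ∃ b, ∀ x, ∑ i ∈ T, c i * f₁ x i = b := by
  have hdep : ¬ LinearIndependent ℝ fun i : T => ((coordMap f₁ i).linear : E n →ₗ[ℝ] ℝ) := by
    intro h
    have := h.fintype_card_le_finrank
    rw [Subspace.dual_finrank_eq] at this
    simp at this
    omega
  obtain ⟨g, hg, i, hi⟩ := Fintype.not_linearIndependent_iff.1 hdep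
  classical
  refine ⟨fun i => if h : i ∈ T then g ⟨i, h⟩ else 0, ⟨i, i.2, by simpa using hi⟩,
    ∑ i : T, g i * f₁ 0 i, fun x => ?_⟩
  rw [← Finset.sum_coe_sort]
  have hx := LinearMap.congr_fun hg x
  simp only [LinearMap.sum_apply, LinearMap.smul_apply, LinearMap.zero_apply, smul_eq_mul] at hx
  have hl : ∀ i : T, f₁ x i = (coordMap f₁ i).linear x + f₁ 0 i := fun i => by
    have := congr_fun (coordMap f₁ i).decomp x
    simpa using this
  simp only [Finset.coe_mem, dite_true, Subtype.coe_eta, hl, mul_add, Finset.sum_add_distrib, hx,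
    zero_add]

/-- If `T` with more than `n` elements were shattered, some `x` would activate in `T` exactly the
units with `c j > 0`, and some `y` those with `c j < 0`. The constant `∑ c j * f₁ · j` is then
non-negative at `x` and non-positive at `y`, and a non-zero `c i` makes one of the two strict. -/
theorem vcDim_activeFamily_le (f₁ : E n →ᵃ[ℝ] E k) : (activeFamily f₁).vcDim ≤ n := by
  classical
  refine Finset.sup_le fun T hT => ?_
  by_contra! hcard
  have hsh := Finset.mem_shatterer.1 hT
  obtain ⟨c, ⟨i, hiT, hi⟩, b, hb⟩ := exists_affine_relation f₁ hcard
  have key : ∀ P : Fin k → Prop, ∃ x, ∀ j ∈ T, (0 < f₁ x j ↔ P j) := fun P => by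
    obtain ⟨u, hu, hTu⟩ := hsh (Finset.filter_subset P T)
    obtain ⟨x, rfl⟩ := (Finset.mem_filter.1 hu).2
    refine ⟨x, fun j hj => ?_⟩
    simpa [hj] using Finset.ext_iff.1 hTu j
  obtain ⟨x, hx⟩ := key fun j => 0 < c j
  obtain ⟨y, hy⟩ := key fun j => c j < 0
  have hx0 : ∀ j ∈ T, 0 ≤ c j * f₁ x j := fun j hj => by
    rcases lt_or_ge 0 (c j) with h | h
    · exact mul_nonneg h.le ((hx j hj).2 h).le
    · exact mul_nonneg_of_nonpos_of_nonpos h (not_lt.1 fun h' => h.not_gt ((hx j hj).1 h'))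
  have hy0 : ∀ j ∈ T, c j * f₁ y j ≤ 0 := fun j hj => by
    rcases lt_or_ge (c j) 0 with h | h
    · exact mul_nonpos_of_nonpos_of_nonneg h.le ((hy j hj).2 h).le
    · exact mul_nonpos_of_nonneg_of_nonpos h (not_lt.1 fun h' => h.not_gt ((hy j hj).1 h'))
  rcases lt_or_gt_of_ne hi with h | h
  · have h1 : ∑ j ∈ T, c j * f₁ y j < 0 :=
      Finset.sum_neg' hy0 ⟨i, hiT, mul_neg_of_neg_of_pos h ((hy i hiT).2 h)⟩
    linarith [hb x, hb y, Finset.sum_nonneg hx0]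
  · have h1 : 0 < ∑ j ∈ T, c j * f₁ x j :=
      Finset.sum_pos' hx0 ⟨i, hiT, mul_pos h ((hx i hiT).2 h)⟩
    linarith [hb x, hb y, Finset.sum_nonpos hy0]

theorem card_activeFamily_le (f₁ : E n →ᵃ[ℝ] E k) :
    (activeFamily f₁).card ≤ ∑ i ∈ Finset.range (n + 1), k.choose i := by
  classical
  refine (Finset.card_le_card_shatterer _).trans (Finset.card_shatterer_le_sum_vcDim.trans ?_)
  rw [Fintype.card_fin]
  refine Finset.sum_le_sum_of_subset fun i hi => ?_
  have := vcDim_activeFamily_le f₁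
  simp only [Finset.mem_Iic, Finset.mem_range] at hi ⊢
  omega

theorem numLinearRegions_le {K : Set (E n)} (hK : Convex ℝ K) {F : K → E m}
    (hF : F ∈ fullNetworks n k m K) :
    numLinearRegions F ≤ ((∑ i ∈ Finset.range (n + 1), k.choose i : ℕ) : ℕ∞) := by
  obtain ⟨f₁, f₂, hF⟩ := hF
  have hx : ∀ D : LinearRegion F, ∃ x ∈ interior D.1, IsGeneric f₁ x := fun D =>
    exists_isGeneric f₁ isOpen_interior D.2.interior_nonempty
  choose x hxD hxg using hx
  let S : LinearRegion F → activeFamily f₁ := fun D =>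
    ⟨activeSet f₁ (x D), by simp [activeFamily]⟩
  have hS : Function.Injective S := fun D D' h => by
    have hSS : activeSet f₁ (x D) = activeSet f₁ (x D') := congr_arg Subtype.val h
    -- Convexity of `K` enters here: the whole cell inside `interior K` is connected, so one linear
    -- region contains it.
    let C := cell f₁ (interior K) (activeSet f₁ (x D))
    have hC : IsOpen C := isOpen_cell f₁ isOpen_interior _
    have hxC : x D ∈ C := mem_cell_of_isGeneric (interior_mono D.2.subset (hxD D)) (hxg D)
    have hxC' : x D' ∈ C := by
      simpa [C, hSS] using mem_cell_of_isGeneric (interior_mono D'.2.subset (hxD D')) (hxg D')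
    obtain ⟨D₀, hD₀, hCD⟩ := exists_isLinearRegion_superset (f := F)
      ((cell_subset _ _ _).trans interior_subset)
      (isRegion_of_convex hC (convex_cell f₁ hK.interior _) ⟨_, hxC⟩)
      ⟨maskedMap f₁ f₂ _, fun y hy => (hF y).trans (cell_eq_maskedMap f₂ hy)⟩
    have hCi : C ⊆ interior D₀ := interior_maximal hCD hC
    exact Subtype.ext ((D.2.eq_of_interior_inter hD₀ ⟨_, hxD D, hCi hxC⟩).trans
      (D'.2.eq_of_interior_inter hD₀ ⟨_, hxD D', hCi hxC'⟩).symm)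
  refine (ENat.card_le_card_of_injective hS).trans ?_
  rw [ENat.card_eq_coe_fintype_card, Fintype.card_coe]
  exact_mod_cast card_activeFamily_le f₁

end UpperBound

/-! ### Entropy bound for binomial coefficients -/

section Entropy

theorem succ_pow_le_eight_mul_pow {m : ℕ} (hm : 0 < m) :
    ((m : ℝ) + 1) ^ (2 * m + 1) ≤ 8 * (m : ℝ) ^ (2 * m + 1) := by
  rcases le_or_gt m 12 with h | h
  -- Equality holds at `m = 1`. From 13 on, the crude bound `e² (1 + 1/m) ≤ 8` suffices; it fails at
  -- 12.
  · interval_cases m <;> norm_num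
  · have hm' : (13 : ℝ) ≤ m := by exact_mod_cast h
    have hm0 : (0 : ℝ) < m := by linarith
    have h1 : (1 + 1 / (m : ℝ)) ^ (2 * m) ≤ Real.exp 1 ^ 2 := by
      calc (1 + 1 / (m : ℝ)) ^ (2 * m) ≤ Real.exp (1 / m) ^ (2 * m) := by
            gcongr
            linarith [Real.add_one_le_exp (1 / (m : ℝ))]
        _ = Real.exp 1 ^ 2 := by
            rw [← Real.exp_nat_mul, ← Real.exp_nat_mul]
            congr 1
            push_cast
            field_simp
    have h2 : Real.exp 1 ^ 2 ≤ 7.39 := by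
      have := Real.exp_one_lt_d9
      nlinarith [Real.exp_pos 1]
    have h3 : 1 + 1 / (m : ℝ) ≤ 14 / 13 := by
      have : 1 / (m : ℝ) ≤ 1 / 13 := one_div_le_one_div_of_le (by norm_num) hm'
      linarith
    have h4 : (1 + 1 / (m : ℝ)) ^ (2 * m + 1) ≤ 8 := by
      rw [pow_succ]
      calc _ ≤ (7.39 : ℝ) * (14 / 13) := by gcongr; exact h1.trans h2
        _ ≤ 8 := by norm_num
    have h5 : (m : ℝ) + 1 = m * (1 + 1 / m) := by field_simp
    rw [h5, mul_pow, mul_comm]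
    gcongr

open Stirling in
theorem stirlingSeq_one_mul_le {m : ℕ} (hm : 0 < m) :
    stirlingSeq 1 * stirlingSeq m ≤ 2 * stirlingSeq (m + 1) := by
  have hm0 : (0 : ℝ) < m := by exact_mod_cast hm
  -- Cancelling the factorial and the powers of `e` reduces the claim to this; its square is
  -- `succ_pow_le_eight_mul_pow`.
  have hs : ((m : ℝ) + 1) ^ m * √((m : ℝ) + 1) ≤ 2 * √2 * ((m : ℝ) ^ m * √(m : ℝ)) := by
    refine le_of_sq_le_sq ?_ (by positivity)
    simp only [mul_pow, Real.sq_sqrt hm0.le, Real.sq_sqrt (by positivity : (0 : ℝ) ≤ m + 1),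
      Real.sq_sqrt (zero_le_two : (0 : ℝ) ≤ 2)]
    have := succ_pow_le_eight_mul_pow hm
    calc _ = ((m : ℝ) + 1) ^ (2 * m + 1) := by ring
      _ ≤ _ := this
      _ = _ := by ring
  rw [stirlingSeq_one, stirlingSeq, stirlingSeq, Nat.factorial_succ]
  push_cast
  rw [Real.sqrt_mul zero_le_two, Real.sqrt_mul zero_le_two, div_pow, div_pow, div_mul_div_comm,
    ← mul_div_assoc (2 : ℝ), div_le_div_iff₀ (by positivity) (by positivity)]
  have he : Real.exp 1 ≠ 0 := (Real.exp_pos 1).ne'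
  have e1 : Real.exp 1 * m.factorial *
      (√2 * √((m : ℝ) + 1) * (((m : ℝ) + 1) ^ (m + 1) / Real.exp 1 ^ (m + 1)))
      = (m.factorial * √2 * (m + 1) / Real.exp 1 ^ m) * (((m : ℝ) + 1) ^ m * √((m : ℝ) + 1)) := by
    field_simp
    ring
  have e2 : 2 * (((m : ℝ) + 1) * m.factorial) *
      (√2 * (√2 * √(m : ℝ) * ((m : ℝ) ^ m / Real.exp 1 ^ m)))
      = (m.factorial * √2 * (m + 1) / Real.exp 1 ^ m) * (2 * √2 * ((m : ℝ) ^ m * √(m : ℝ))) := by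
    ring
  rw [e1, e2]
  gcongr

open Stirling in
-- The sequence decreases to `√π`. From index 2 on it is at most `e² / 4`, and `(e² / 4)² < 2 √π`.
-- The value at 1 is too large for this argument, so index 1 is treated separately.
theorem stirlingSeq_mul_le {k m : ℕ} (hk : 0 < k) (hm : 0 < m) :
    stirlingSeq k * stirlingSeq m ≤ 2 * stirlingSeq (k + m) := by
  rcases (Nat.succ_le_of_lt hk).eq_or_lt with rfl | hk2
  · rw [add_comm]
    exact stirlingSeq_one_mul_le hm
  rcases (Nat.succ_le_of_lt hm).eq_or_lt with rfl | hm2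
  · rw [mul_comm]
    exact stirlingSeq_one_mul_le hk
  have hle : ∀ j : ℕ, 1 < j → stirlingSeq j ≤ 1.8475 ∧ 0 ≤ stirlingSeq j := fun j hj => by
    obtain ⟨i, rfl⟩ : ∃ i, j = i + 1 := ⟨j - 1, by omega⟩
    refine ⟨(stirlingSeq'_antitone (show 1 ≤ i by omega)).trans ?_, (stirlingSeq'_pos i).le⟩
    have h4 : √(2 * 2 : ℝ) = 2 := Real.sqrt_mul_self zero_le_two
    have : stirlingSeq 2 = Real.exp 1 ^ 2 / 4 := by
      rw [stirlingSeq, Nat.cast_ofNat, h4, div_pow, Nat.factorial_two]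
      have := Real.exp_pos 1
      field_simp
      norm_num
    change stirlingSeq 2 ≤ _
    rw [this]
    have := Real.exp_one_lt_d9
    nlinarith [Real.exp_pos 1]
  have hpi : (1.76 : ℝ) ≤ √Real.pi :=
    Real.le_sqrt_of_sq_le (by linarith [Real.pi_gt_d2])
  calc stirlingSeq k * stirlingSeq m ≤ 1.8475 * 1.8475 :=
        mul_le_mul (hle k hk2).1 (hle m hm2).1 (hle m hm2).2 (by norm_num)
    _ ≤ 2 * √Real.pi := by linarith
    _ ≤ 2 * stirlingSeq (k + m) := by
        gcongr
        exact sqrt_pi_le_stirlingSeq (by omega)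

theorem factorial_eq_stirlingSeq_mul {n : ℕ} (hn : 0 < n) :
    (n.factorial : ℝ) = Stirling.stirlingSeq n * (√(2 * n : ℝ) * (n / Real.exp 1) ^ n) := by
  have : (0 : ℝ) < n := by exact_mod_cast hn
  rw [Stirling.stirlingSeq, div_mul_cancel₀]
  positivity

theorem pow_div_le_choose_mul_sqrt {k m : ℕ} (hk : 0 < k) (hm : 0 < m) :
    ((k : ℝ) + m) ^ (k + m) / ((k : ℝ) ^ k * (m : ℝ) ^ m)
      ≤ (k + m).choose k * √(8 * k * (m / (k + m))) := by
  have hk0 : (0 : ℝ) < k := by exact_mod_cast hk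
  have hm0 : (0 : ℝ) < m := by exact_mod_cast hm
  have hch : ((k + m).choose k : ℝ) * (k.factorial * m.factorial) = (k + m).factorial := by
    rw [← mul_assoc]
    have := Nat.choose_mul_factorial_mul_factorial (Nat.le_add_right k m)
    rw [Nat.add_sub_cancel_left] at this
    exact_mod_cast this
  have hkm : (0 : ℝ) < k.factorial * m.factorial := by
    exact_mod_cast Nat.mul_pos k.factorial_pos m.factorial_pos
  refine le_of_mul_le_mul_right ?_ hkm
  rw [mul_right_comm, hch, factorial_eq_stirlingSeq_mul hk, factorial_eq_stirlingSeq_mul hm,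
    factorial_eq_stirlingSeq_mul (Nat.add_pos_left hk m)]
  push_cast
  have hs := stirlingSeq_mul_le hk hm
  set a := Stirling.stirlingSeq k
  set b := Stirling.stirlingSeq m
  set c := Stirling.stirlingSeq (k + m)
  have he := Real.exp_pos 1
  -- The two square-root factors are `2 √(km)` and `4 √(km)`; their ratio is the factor 2 in
  -- `stirlingSeq_mul_le`.
  have r1 : √(2 * k : ℝ) * √(2 * m : ℝ) = 2 * √(k * m : ℝ) := by
    rw [← Real.sqrt_mul (by positivity), show (2 * k * (2 * m) : ℝ) = 2 ^ 2 * (k * m) by ring,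
      Real.sqrt_mul (by positivity), Real.sqrt_sq zero_le_two]
  have r2 : √(2 * (k + m) : ℝ) * √(8 * k * (m / (k + m)) : ℝ) = 4 * √(k * m : ℝ) := by
    rw [← Real.sqrt_mul (by positivity),
      show (2 * (k + m) * (8 * k * (m / (k + m))) : ℝ) = 4 ^ 2 * (k * m) by field_simp; ring,
      Real.sqrt_mul (by positivity), Real.sqrt_sq (by norm_num)]
  calc _ = (((k : ℝ) + m) ^ (k + m) / Real.exp 1 ^ (k + m) * (√(2 * k : ℝ) * √(2 * m : ℝ)))
        * (a * b) := by
        rw [div_pow, div_pow, pow_add (Real.exp 1)]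
        field_simp
    _ ≤ (((k : ℝ) + m) ^ (k + m) / Real.exp 1 ^ (k + m) * (√(2 * k : ℝ) * √(2 * m : ℝ)))
        * (2 * c) := by gcongr
    _ = (((k : ℝ) + m) ^ (k + m) / Real.exp 1 ^ (k + m) * c) * (4 * √(k * m : ℝ)) := by
        rw [r1]; ring
    _ = _ := by rw [← r2, div_pow]; ring

theorem two_rpow_binaryEntropy {k m : ℕ} (hk : 0 < k) (hm : 0 < m) :
    (2 : ℝ) ^ (((k : ℝ) + m) * binaryEntropy ((k : ℝ) / (k + m)))
      = ((k : ℝ) + m) ^ (k + m) / ((k : ℝ) ^ k * (m : ℝ) ^ m) := by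
  have hk0 : (0 : ℝ) < k := by exact_mod_cast hk
  have hm0 : (0 : ℝ) < m := by exact_mod_cast hm
  have h1 : 1 - (k : ℝ) / (k + m) = m / (k + m) := by field_simp; ring
  have h2 : ((k : ℝ) + m) * binaryEntropy ((k : ℝ) / (k + m))
      = -(Real.logb 2 (k / (k + m)) * k + Real.logb 2 (m / (k + m)) * m) := by
    rw [binaryEntropy, h1]
    field_simp
    ring
  rw [h2, Real.rpow_neg zero_le_two, Real.rpow_add zero_lt_two, Real.rpow_mul zero_le_two,
    Real.rpow_mul zero_le_two, Real.rpow_logb zero_lt_two (by norm_num) (by positivity),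
    Real.rpow_logb zero_lt_two (by norm_num) (by positivity), Real.rpow_natCast,
    Real.rpow_natCast, div_pow, div_pow, pow_add]
  field_simp

/-- The entropy bound for binomial coefficients. -/
theorem two_rpow_entropy_div_sqrt_le_choose {k n : ℕ} (hk : 0 < k) (hkn : k < n) :
    (2 : ℝ) ^ ((n : ℝ) * binaryEntropy ((k : ℝ) / n)) / √(8 * (k : ℝ) * (1 - (k : ℝ) / n))
      ≤ n.choose k := by
  obtain ⟨m, rfl⟩ := Nat.exists_eq_add_of_lt hkn
  have hm : 0 < m + 1 := m.succ_pos
  rw [add_assoc]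
  generalize m + 1 = m at hm ⊢
  have hk0 : (0 : ℝ) < k := by exact_mod_cast hk
  have hm0 : (0 : ℝ) < m := by exact_mod_cast hm
  push_cast
  have h1 : 1 - (k : ℝ) / (k + m) = m / (k + m) := by field_simp; ring
  rw [two_rpow_binaryEntropy hk hm, h1, div_le_iff₀ (by positivity)]
  exact pow_div_le_choose_mul_sqrt hk hm

end Entropy

/-! ### Lower bound by the moment curve -/

section LowerBound

variable {n k m : ℕ}

/-- The squared norms are polynomials in the weights, pairwise distinct for distinct `S`. The
product of their differences is a non-zero polynomial, hence non-zero at some `c`. -/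
theorem exists_weights_norm_injective (a : Fin k → E n) (ha : ∀ i, a i ≠ 0) :
    ∃ c : Fin k → ℝ, Function.Injective fun S : Finset (Fin k) => ‖∑ i ∈ S, c i • a i‖ := by
  classical
  let P : Finset (Fin k) → MvPolynomial (Fin k) ℝ := fun S =>
    ∑ j : Fin n, (∑ i ∈ S, MvPolynomial.X i * MvPolynomial.C (a i j)) ^ 2
  have hP : ∀ S c, MvPolynomial.eval c (P S) = ‖∑ i ∈ S, c i • a i‖ ^ 2 := fun S c => by
    simp [P, EuclideanSpace.real_norm_sq_eq]
  have hinj : Function.Injective P := fun S T h => by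
    ext j
    -- At the `j`-th unit vector the polynomial of `S` equals `‖a j‖²` if `j ∈ S` and zero
    -- otherwise.
    have hj := congr_arg (MvPolynomial.eval (Pi.single j 1)) h
    have hsum : ∀ U : Finset (Fin k), ∑ i ∈ U, (Pi.single j 1 : Fin k → ℝ) i • a i
        = if j ∈ U then a j else 0 := fun U => by
      simp [Pi.single_apply]
    rw [hP, hP, hsum, hsum] at hj
    split_ifs at hj with hS hT hT
    · exact iff_of_true hS hT
    · exact absurd hj (by simpa using ha j)
    · exact absurd hj.symm (by simpa using ha j)
    · exact iff_of_false hS hT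
  have hQ : ∏ p ∈ (Finset.univ : Finset (Finset (Fin k))).offDiag, (P p.1 - P p.2) ≠ 0 :=
    Finset.prod_ne_zero_iff.2 fun p hp =>
      sub_ne_zero.2 fun h => (Finset.mem_offDiag.1 hp).2.2 (hinj h)
  obtain ⟨c, hc⟩ : ∃ c, MvPolynomial.eval c
      (∏ p ∈ (Finset.univ : Finset (Finset (Fin k))).offDiag, (P p.1 - P p.2)) ≠ 0 := by
    by_contra! h
    exact hQ (MvPolynomial.funext fun c => by simpa using h c)
  refine ⟨c, fun S T h => ?_⟩
  by_contra hST
  rw [map_prod] at hc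
  refine Finset.prod_ne_zero_iff.1 hc (S, T) (by simpa using hST) ?_
  rw [map_sub, hP, hP]
  exact sub_eq_zero.2 (congr_arg (· ^ 2) h)

open Polynomial in
/-- A monic polynomial of degree `n` that changes sign in `[0, ∞)` just at the points `g + 1 / 2`
with `g ∈ G`. -/
noncomputable def signPoly (n : ℕ) (G : Finset (Fin k)) : ℝ[X] :=
  (∏ g ∈ G, (X - C ((g : ℝ) + 1 / 2))) * (X - C (-1)) ^ (n - G.card)

theorem signPoly_monic (G : Finset (Fin k)) : (signPoly n G).Monic :=
  (Polynomial.monic_prod_of_monic _ _ fun _ _ => Polynomial.monic_X_sub_C _).mul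
    ((Polynomial.monic_X_sub_C _).pow _)

theorem natDegree_signPoly {G : Finset (Fin k)} (hG : G.card ≤ n) :
    (signPoly n G).natDegree = n := by
  rw [signPoly, Polynomial.Monic.natDegree_mul
    (Polynomial.monic_prod_of_monic _ _ fun _ _ => Polynomial.monic_X_sub_C _)
    ((Polynomial.monic_X_sub_C _).pow _), Polynomial.natDegree_prod_of_monic _ _
    fun _ _ => Polynomial.monic_X_sub_C _, (Polynomial.monic_X_sub_C _).natDegree_pow]
  simp only [Polynomial.natDegree_X_sub_C, Finset.sum_const, smul_eq_mul, mul_one]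
  omega

theorem eval_signPoly (G : Finset (Fin k)) (t : ℝ) : (signPoly n G).eval t
    = (∏ g ∈ G, (t - ((g : ℝ) + 1 / 2))) * (t + 1) ^ (n - G.card) := by
  simp [signPoly, Polynomial.eval_prod]

theorem natCast_sub_add_half_ne_zero (i g : ℕ) : (i : ℝ) - ((g : ℝ) + 1 / 2) ≠ 0 := by
  intro h
  have h2 : (2 * i : ℝ) = 2 * g + 1 := by linarith
  have h3 : 2 * i = 2 * g + 1 := by exact_mod_cast h2
  omega

theorem eval_signPoly_ne_zero (G : Finset (Fin k)) (i : ℕ) : (signPoly n G).eval (i : ℝ) ≠ 0 := by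
  rw [eval_signPoly]
  exact mul_ne_zero (Finset.prod_ne_zero_iff.2 fun g _ => natCast_sub_add_half_ne_zero i g)
    (by positivity)

theorem eval_signPoly_pos (G : Finset (Fin k)) : 0 < (signPoly n G).eval (k : ℝ) := by
  rw [eval_signPoly]
  refine mul_pos (Finset.prod_pos fun g _ => ?_) (by positivity)
  have : ((g : ℕ) : ℝ) + 1 ≤ k := by exact_mod_cast g.2
  linarith

/-- Between `i` and `i + 1` the only possible root is `i + 1 / 2`; the padding root `-1` causes no
sign change on `[0, ∞)`. -/
theorem mem_iff_eval_signPoly_mul_neg (G : Finset (Fin k)) (i : Fin k) : i ∈ G ↔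
    (signPoly n G).eval ((i : ℕ) : ℝ) * (signPoly n G).eval (((i : ℕ) + 1 : ℕ) : ℝ) < 0 := by
  have hpos : ∀ g : Fin k, g ≠ i →
      0 < (((i : ℕ) : ℝ) - ((g : ℝ) + 1 / 2)) * ((((i : ℕ) + 1 : ℕ) : ℝ) - ((g : ℝ) + 1 / 2)) := by
    intro g hg
    push_cast
    rcases lt_or_gt_of_ne (Fin.val_ne_of_ne hg) with h | h
    · have : ((g : ℕ) : ℝ) + 1 ≤ (i : ℕ) := by exact_mod_cast h
      exact mul_pos (by linarith) (by linarith)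
    · have : ((i : ℕ) : ℝ) + 1 ≤ (g : ℕ) := by exact_mod_cast h
      exact mul_pos_of_neg_of_neg (by linarith) (by linarith)
  have hq : 0 < (((i : ℕ) : ℝ) + 1) ^ (n - G.card) *
      ((((i : ℕ) + 1 : ℕ) : ℝ) + 1) ^ (n - G.card) := by positivity
  rw [eval_signPoly, eval_signPoly, mul_mul_mul_comm, ← Finset.prod_mul_distrib]
  constructor
  · intro hi
    rw [← Finset.mul_prod_erase _ _ hi]
    refine mul_neg_of_neg_of_pos (mul_neg_of_neg_of_pos (by push_cast; ring_nf; norm_num)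
      (Finset.prod_pos fun g hg => hpos g (Finset.ne_of_mem_erase hg))) hq
  · intro h
    by_contra hi
    exact h.not_gt (mul_pos (Finset.prod_pos fun g hg => hpos g fun h' => hi (h' ▸ hg)) hq)

/-- Detecting `k - 1 ∈ G` needs the sign at `k`, where there is no unit; it is always positive
because every root is smaller than `k`. -/
theorem eq_of_eval_signPoly_pos_iff {G G' : Finset (Fin k)}
    (h : ∀ i : Fin k, 0 < (signPoly n G).eval ((i : ℕ) : ℝ) ↔
      0 < (signPoly n G').eval ((i : ℕ) : ℝ)) : G = G' := by
  have h' : ∀ i : ℕ, i ≤ k → (0 < (signPoly n G).eval (i : ℝ) ↔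
      0 < (signPoly n G').eval (i : ℝ)) := fun i hi => by
    rcases hi.eq_or_lt with rfl | hi
    · exact iff_of_true (eval_signPoly_pos G) (eval_signPoly_pos G')
    · exact h ⟨i, hi⟩
  have key : ∀ {x y x' y' : ℝ}, x ≠ 0 → y ≠ 0 → x' ≠ 0 → y' ≠ 0 → (0 < x ↔ 0 < x') →
      (0 < y ↔ 0 < y') → (x * y < 0 ↔ x' * y' < 0) := by
    intro x y x' y' hx hy hx' hy' h1 h2
    rw [mul_neg_iff, mul_neg_iff]
    grind
  ext i
  rw [mem_iff_eval_signPoly_mul_neg (n := n), mem_iff_eval_signPoly_mul_neg (n := n) G']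
  exact key (eval_signPoly_ne_zero _ _) (eval_signPoly_ne_zero _ _) (eval_signPoly_ne_zero _ _)
    (eval_signPoly_ne_zero _ _) (h' _ i.2.le) (h' _ i.2)

/-- The point `(1, t, …, t ^ (n - 1))` of the moment curve. -/
noncomputable def momentPoint (n : ℕ) (t : ℝ) : E n := WithLp.toLp 2 fun j => t ^ (j : ℕ)

theorem momentPoint_ne_zero (hn : 0 < n) (t : ℝ) : momentPoint n t ≠ 0 := fun h => by
  have := congr_arg (fun v : E n => v ⟨0, hn⟩) h
  simp [momentPoint] at this

/-- The point whose coordinates are the lower coefficients of `signPoly n G`. -/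
noncomputable def signPoint (n : ℕ) (G : Finset (Fin k)) : E n :=
  WithLp.toLp 2 fun j => (signPoly n G).coeff j

/-- The bound on `G.card` makes the degree exactly `n`, so `t ^ n` is the leading term. -/
theorem inner_momentPoint_signPoint {G : Finset (Fin k)} (hG : G.card ≤ n) (t : ℝ) :
    inner ℝ (momentPoint n t) (signPoint n G) + t ^ n = (signPoly n G).eval t := by
  have h1 : (signPoly n G).coeff n = 1 := by
    simpa [natDegree_signPoly hG] using (signPoly_monic (n := n) G).coeff_natDegree
  rw [Polynomial.eval_eq_sum_range, natDegree_signPoly hG, Finset.sum_range_succ, h1, one_mul,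
    ← Fin.sum_univ_eq_sum_range (fun j => (signPoly n G).coeff j * t ^ j)]
  simp [PiLp.inner_apply, momentPoint, signPoint]

/-- The linear map with rows `a i`. -/
noncomputable def rowMap (a : Fin k → E n) : E n →ₗ[ℝ] E k where
  toFun x := WithLp.toLp 2 fun i => inner ℝ (a i) x
  map_add' x y := by ext i; simp [inner_add_right]
  map_smul' c x := by ext i; simp [inner_smul_right]

@[simp]
theorem rowMap_apply (a : Fin k → E n) (x : E n) (i : Fin k) :
    rowMap a x i = inner ℝ (a i) x := rfl

/-- The affine map `x ↦ a (x - x₀) + b`. -/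
noncomputable def rowAffineMap (a : Fin k → E n) (x₀ : E n) (b : E k) : E n →ᵃ[ℝ] E k :=
  (rowMap a).toAffineMap + AffineMap.const ℝ (E n) (b - rowMap a x₀)

theorem rowAffineMap_apply (a : Fin k → E n) (x₀ : E n) (b : E k) (x : E n) (i : Fin k) :
    rowAffineMap a x₀ b x i = inner ℝ (a i) (x - x₀) + b i := by
  simp [rowAffineMap, inner_sub_right]
  ring

/-- The linear map `v ↦ (∑ i, c i * v i) • e`. -/
noncomputable def outputMap (c : Fin k → ℝ) (e : E m) : E k →ₗ[ℝ] E m where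
  toFun v := (∑ i, c i * v i) • e
  map_add' v w := by simp [mul_add, Finset.sum_add_distrib, add_smul]
  map_smul' r v := by simp [Finset.mul_sum, mul_left_comm, smul_smul]

theorem maskedMap_linear_apply (a : Fin k → E n) (x₀ : E n) (b : E k) (c : Fin k → ℝ) (e : E m)
    (S : Finset (Fin k)) (v : E n) :
    (maskedMap (rowAffineMap a x₀ b) (outputMap c e).toAffineMap S).linear v
      = (inner ℝ (∑ i ∈ S, c i • a i) v : ℝ) • e := by
  change (∑ i, c i * (mask S ((rowAffineMap a x₀ b).linear v)) i) • e = _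
  have : (rowAffineMap a x₀ b).linear v = rowMap a v := by
    simp [rowAffineMap]
  simp [this, sum_inner, inner_smul_left, Finset.sum_ite_mem]

/-! ### Gradient norms as invariants of equivalence -/

section Equivalence

variable {K : Set (E n)} {F : K → E m}

/-- The affine maps satisfy `A = A' ∘ φ`. Applying the linear parts to `g` and using Cauchy–Schwarz
gives `‖g‖² ≤ ‖g'‖ ‖g‖`. -/
theorem norm_le_of_euclideanEquiv {D D' : Set (E n)} (hD : D ⊆ K) (hD' : D' ⊆ K)
    (hne : (interior D).Nonempty) (h : EuclideanEquiv F D D') {A A' : E n →ᵃ[ℝ] E m}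
    (hA : ∀ x : K, (x : E n) ∈ D → F x = A x) (hA' : ∀ x : K, (x : E n) ∈ D' → F x = A' x)
    {g g' : E n} {e : E m} (he : e ≠ 0) (hg : ∀ v, A.linear v = (inner ℝ g v : ℝ) • e)
    (hg' : ∀ v, A'.linear v = (inner ℝ g' v : ℝ) • e) : ‖g‖ ≤ ‖g'‖ := by
  obtain ⟨φ, hφ, hF⟩ := h
  have hAA : A = A'.comp φ.toAffineEquiv.toAffineMap := by
    refine affineMap_eq_of_agree hne hD hA fun x hx => ?_
    have hφx : φ x ∈ D' := hφ ▸ Set.mem_image_of_mem φ hx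
    exact (hF x ⟨φ x, hD' hφx⟩ hx rfl).trans (hA' _ hφx)
  have h1 : A.linear g = A'.linear (φ.linearIsometryEquiv g) := by rw [hAA]; rfl
  rw [hg, hg'] at h1
  have h2 := smul_left_injective ℝ he h1
  have h3 : ‖g‖ * ‖g‖ ≤ ‖g'‖ * ‖g‖ := by
    rw [← real_inner_self_eq_norm_mul_norm, h2]
    simpa using real_inner_le_norm g' (φ.linearIsometryEquiv g)
  rcases (norm_nonneg g).eq_or_lt with h | h
  · rw [← h]; exact norm_nonneg _
  · exact le_of_mul_le_mul_right h3 h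

/-- Generic points at which the gradients have different norms lie in inequivalent
linear regions. -/
theorem card_le_complexity {ι : Type*} {f₁ : E n →ᵃ[ℝ] E k} {f₂ : E k →ᵃ[ℝ] E m}
    (hF : ∀ x : K, F x = f₂ (relu (f₁ x))) {y : ι → E n} (hy : ∀ t, y t ∈ interior K)
    (hgen : ∀ t, IsGeneric f₁ (y t)) {g : ι → E n} {e : E m} (he : e ≠ 0)
    (hg : ∀ t v, (maskedMap f₁ f₂ (activeSet f₁ (y t))).linear v = (inner ℝ (g t) v : ℝ) • e)
    (hinj : Function.Injective fun t => ‖g t‖) : ENat.card ι ≤ complexity F := by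
  have hD : ∀ t, ∃ D, IsLinearRegion F D ∧
      ∀ x : K, (x : E n) ∈ D → F x = maskedMap f₁ f₂ (activeSet f₁ (y t)) x := fun t => by
    -- Since `K` need not be convex, the cell is cut down to a ball, which keeps it connected and
    -- inside `K`.
    obtain ⟨r, hr, hrK⟩ := Metric.isOpen_iff.1 isOpen_interior _ (hy t)
    have hC := isOpen_cell f₁ (Metric.isOpen_ball (x := y t) (ε := r)) (activeSet f₁ (y t))
    have hyC := mem_cell_of_isGeneric (Metric.mem_ball_self hr) (hgen t)
    have hCK : cell f₁ (Metric.ball (y t) r) (activeSet f₁ (y t)) ⊆ K :=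
      (cell_subset _ _ _).trans (hrK.trans interior_subset)
    have hCF : ∀ x : K, (x : E n) ∈ cell f₁ (Metric.ball (y t) r) (activeSet f₁ (y t)) →
        F x = maskedMap f₁ f₂ (activeSet f₁ (y t)) x := fun x hx =>
      (hF x).trans (cell_eq_maskedMap f₂ hx)
    obtain ⟨D, hD, hCD⟩ := exists_isLinearRegion_superset hCK
      (isRegion_of_convex hC (convex_cell f₁ (convex_ball _ _) _) ⟨_, hyC⟩) ⟨_, hCF⟩
    obtain ⟨A, hA⟩ := hD.1.2.2
    refine ⟨D, hD, fun x hx => ?_⟩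
    rw [hA x hx, affineMap_eq_of_agree ⟨y t, interior_maximal subset_rfl hC hyC⟩ hCK
      (fun z hz => hA z (hCD hz)) hCF]
  choose D hD hDF using hD
  refine ENat.card_le_card_of_injective (f := fun t =>
    (Quotient.mk (linearRegionSetoid F) ⟨D t, hD t⟩)) fun t s hts => hinj ?_
  have h : EuclideanEquiv F (D t) (D s) := Quotient.exact hts
  exact le_antisymm
    (norm_le_of_euclideanEquiv (hD t).subset (hD s).subset (hD t).interior_nonempty h
      (hDF t) (hDF s) he (hg t) (hg s))
    (norm_le_of_euclideanEquiv (hD s).subset (hD t).subset (hD s).interior_nonempty h.symm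
      (hDF s) (hDF t) he (hg s) (hg t))

end Equivalence

theorem card_finset_card_le (n k : ℕ) : ENat.card {G : Finset (Fin k) // G.card ≤ n}
    = ((∑ i ∈ Finset.range (n + 1), k.choose i : ℕ) : ℕ∞) := by
  classical
  rw [ENat.card_eq_coe_fintype_card, Fintype.card_subtype,
    Finset.card_eq_sum_card_fiberwise (f := Finset.card) (t := Finset.range (n + 1))
      (fun G hG => by simpa [Nat.lt_succ_iff] using hG)]
  congr 1
  refine Finset.sum_congr rfl fun i hi => ?_
  have hc := Finset.card_powersetCard i (Finset.univ : Finset (Fin k))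
  rw [Finset.card_univ, Fintype.card_fin] at hc
  rw [Finset.filter_filter, ← hc]
  congr 1
  ext G
  simp only [Finset.mem_filter, Finset.mem_univ, true_and, Finset.mem_powersetCard,
    Finset.subset_univ, Finset.mem_range] at hi ⊢
  omega

theorem exists_network_le_complexity (n k : ℕ) (hm : 0 < m) {K : Set (E n)}
    (hK : (interior K).Nonempty) : ∃ F ∈ fullNetworks n k m K,
      ((∑ i ∈ Finset.range (n + 1), k.choose i : ℕ) : ℕ∞) ≤ complexity F := by
  obtain ⟨x₀, hx₀⟩ := hK
  have hlim : Filter.Tendsto (fun ε : ℝ => fun G : Finset (Fin k) => x₀ + ε • signPoint n G)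
      (nhdsWithin 0 (Set.Ioi 0)) (nhds fun _ => x₀) := by
    refine tendsto_nhdsWithin_of_tendsto_nhds (tendsto_pi_nhds.2 fun G => ?_)
    have : Continuous fun ε : ℝ => x₀ + ε • signPoint n G := by fun_prop
    simpa using this.tendsto 0
  have hev : ∀ᶠ ε : ℝ in nhdsWithin 0 (Set.Ioi 0),
      ∀ G : Finset (Fin k), x₀ + ε • signPoint n G ∈ interior K :=
    Filter.eventually_all.2 fun G =>
      (tendsto_pi_nhds.1 hlim G).eventually (isOpen_interior.mem_nhds hx₀)
  obtain ⟨ε, hεK, hε⟩ := (hev.and self_mem_nhdsWithin).exists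
  replace hε : 0 < ε := hε
  let a : Fin k → E n := fun i => momentPoint n (i : ℕ)
  -- The offset carries the same `ε` as the points, so each unit takes the value `ε` times that of
  -- the polynomial, with unchanged sign.
  let f₁ := rowAffineMap a x₀ (WithLp.toLp 2 fun i : Fin k => ε * ((i : ℕ) : ℝ) ^ n)
  have hval : ∀ G : Finset (Fin k), G.card ≤ n → ∀ i : Fin k,
      f₁ (x₀ + ε • signPoint n G) i = ε * (signPoly n G).eval ((i : ℕ) : ℝ) := fun G hG i => by
    rw [← inner_momentPoint_signPoint hG]
    simp [f₁, rowAffineMap_apply, inner_smul_right, a, mul_add]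
  obtain ⟨c, hc⟩ : ∃ c : Fin k → ℝ,
      Function.Injective fun G : {G : Finset (Fin k) // G.card ≤ n} =>
        ‖∑ i ∈ activeSet f₁ (x₀ + ε • signPoint n G.1), c i • a i‖ := by
    -- For `n = 0` all gradients vanish, but only the empty `G` is admissible.
    rcases n.eq_zero_or_pos with rfl | hn
    · have : Subsingleton {G : Finset (Fin k) // G.card ≤ 0} := ⟨fun G G' => Subtype.ext (by
        rw [Finset.card_eq_zero.1 (Nat.le_zero.1 G.2), Finset.card_eq_zero.1 (Nat.le_zero.1 G'.2)])⟩
      exact ⟨0, Function.injective_of_subsingleton _⟩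
    · obtain ⟨c, hc⟩ := exists_weights_norm_injective a fun i => momentPoint_ne_zero hn _
      refine ⟨c, fun G G' h => Subtype.ext (eq_of_eval_signPoly_pos_iff (n := n) fun i => ?_)⟩
      have hi := Finset.ext_iff.1 (hc h) i
      simpa [hval _ G.2, hval _ G'.2, hε] using hi
  let e : E m := EuclideanSpace.single ⟨0, hm⟩ 1
  let f₂ := (outputMap c e).toAffineMap
  refine ⟨fun x => f₂ (relu (f₁ x)), ⟨f₁, f₂, fun _ => rfl⟩, ?_⟩
  rw [← card_finset_card_le]
  refine card_le_complexity (fun _ => rfl) (fun G => hεK G.1) (fun G i _ => ?_)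
    (e := e) (by simp [e]) (fun G v => maskedMap_linear_apply _ _ _ _ _ _ _) hc
  rw [hval _ G.2]
  exact mul_ne_zero hε.ne' (eval_signPoly_ne_zero _ _)

end LowerBound

end ReluRegions

theorem mainTheorem1 (n₀ n₁ n₂ : ℕ) (hn₂ : 0 < n₂)
    (K : Set (ReluRegions.E n₀)) (hKcompact : IsCompact K) (hKconn : IsConnected K)
    (hKdim : (interior K).Nonempty) :
    (Convex ℝ K →
      ReluRegions.maxComplexity (ReluRegions.fullNetworks n₀ n₁ n₂ K)
          = ReluRegions.maxLinearRegions (ReluRegions.fullNetworks n₀ n₁ n₂ K) ∧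
      ReluRegions.maxLinearRegions (ReluRegions.fullNetworks n₀ n₁ n₂ K)
          = ((∑ i ∈ Finset.range (n₀ + 1), n₁.choose i : ℕ) : ℕ∞) ∧
      ∃ F ∈ ReluRegions.fullNetworks n₀ n₁ n₂ K,
        ReluRegions.complexity F = ((∑ i ∈ Finset.range (n₀ + 1), n₁.choose i : ℕ) : ℕ∞)) ∧
    ((∑ i ∈ Finset.range (n₀ + 1), n₁.choose i : ℕ) : ℕ∞)
        ≤ ReluRegions.maxComplexity (ReluRegions.fullNetworks n₀ n₁ n₂ K) ∧
    ReluRegions.maxComplexity (ReluRegions.fullNetworks n₀ n₁ n₂ K)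
        ≤ ReluRegions.maxLinearRegions (ReluRegions.fullNetworks n₀ n₁ n₂ K) ∧
    (0 < n₀ → n₀ < n₁ →
      ENNReal.ofReal
          ((2 : ℝ) ^ ((n₁ : ℝ) * ReluRegions.binaryEntropy ((n₀ : ℝ) / (n₁ : ℝ)))
            / Real.sqrt (8 * (n₀ : ℝ) * (1 - (n₀ : ℝ) / (n₁ : ℝ))))
        ≤ ((ReluRegions.maxComplexity (ReluRegions.fullNetworks n₀ n₁ n₂ K) : ℕ∞) : ℝ≥0∞)) := by
  obtain ⟨F, hF, hFc⟩ := ReluRegions.exists_network_le_complexity n₀ n₁ hn₂ hKdim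
  have hlow : ((∑ i ∈ Finset.range (n₀ + 1), n₁.choose i : ℕ) : ℕ∞)
      ≤ ReluRegions.maxComplexity (ReluRegions.fullNetworks n₀ n₁ n₂ K) :=
    hFc.trans (le_iSup₂ (f := fun F _ => ReluRegions.complexity F) F hF)
  have hle := ReluRegions.maxComplexity_le_maxLinearRegions (ReluRegions.fullNetworks n₀ n₁ n₂ K)
  refine ⟨fun hconv => ?_, hlow, hle, fun h0 h1 => ?_⟩
  · have hup : ReluRegions.maxLinearRegions (ReluRegions.fullNetworks n₀ n₁ n₂ K)
        ≤ ((∑ i ∈ Finset.range (n₀ + 1), n₁.choose i : ℕ) : ℕ∞) :=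
      iSup₂_le fun F hF => ReluRegions.numLinearRegions_le hconv hF
    exact ⟨hle.antisymm (hup.trans hlow), hup.antisymm (hlow.trans hle), F, hF,
      ((ReluRegions.complexity_le_numLinearRegions F).trans
        (ReluRegions.numLinearRegions_le hconv hF)).antisymm hFc⟩
  · have hchoose : n₁.choose n₀ ≤ ∑ i ∈ Finset.range (n₀ + 1), n₁.choose i :=
      Finset.single_le_sum (f := fun i => n₁.choose i) (fun _ _ => Nat.zero_le _)
        (Finset.self_mem_range_succ n₀)
    calc _ ≤ ENNReal.ofReal (n₁.choose n₀ : ℝ) :=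
          ENNReal.ofReal_le_ofReal (ReluRegions.two_rpow_entropy_div_sqrt_le_choose h0 h1)
      _ = ((n₁.choose n₀ : ℕ∞) : ℝ≥0∞) := by simp
      _ ≤ _ := ENat.toENNReal_mono ((Nat.cast_le.2 hchoose).trans hlow)
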